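/- **Setting.** Let $(\Omega,\mathcal F,\mathbb P;(\mathcal F_t)_{t\in\mathbb N})$, $\mathbb N=\{0,1,2,\dots\}$, be a filtered probability space carrying a standard symmetric random walk $S=(S_t)_{t\in\mathbb N}$ on $\mathbb Z$: $S$ is adapted, $S_0=0$, and for every $t$ the increment $S_{t+1}-S_t$ is independent of $\mathcal F_t$ and equals $\pm1$ with probability $1/2$ each. Assume that there is an $\mathcal F_0$-measurable random variable that is uniformly distributed on $[0,1]$ and independent of $S$ (so randomization is allowed). For $T\in\mathbb N$ let $\mathcal T_T$ be the set of $(\mathcal F_t)$-stopping times $\tau$ with $\tau\in[0,T]$ almost surely. For a probability measure $\mu$ on $\mathbb Z$ that has a finite first moment and is centered ($\sum_y y\,\mu(\{y\})=0$), put $U_\mu(x)=\sum_{y\in\mathbb Z}|x-y|\,\mu(\{y\})$ and define recursively, for $x\in\mathbb Z$, $$U^\mu_0(x)=|x|,\qquad U^\mu_t(x)=\min\Big\{\tfrac12\big(U^\mu_{t-1}(x-1)+U^\mu_{t-1}(x+1)\big),\,U_\mu(x)\Big\},\quad t=1,2,\dots$$ A *barrier* is a family $\mathbf b=(b(x))_{x\in\mathbb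 Z}$ of integers with $b(x)\ge|x|$ and $b(x)-x$ even for all $x$; let $\mathbf r=(r(x))_{x\in\mathbb Z}$ with $r(x)\in[0,1]$. A family of *coins* for $(\mathbf b,\mathbf r)$ is a family $\{\xi_{t,x}:t\in\mathbb N,\,x\in\mathbb Z\}$ of $\mathcal F_0$-measurable $\{0,1\}$-valued random variables, mutually independent and jointly independent of $S$, such that $\mathbb P(\xi_{t,x}=0)$ equals $0$ if $t<b(x)$, $r(x)$ if $t=b(x)$, and $1$ if $t>b(x)$. The corresponding *randomized Root stopping time* is $$\tau_R(\mathbf b,\mathbf r)=\inf\{t\in\mathbb N:\ t\ge b(S_t)\ \text{and}\ \xi_{t,S_t}=0\}.$$ **Theorem.** Let $T\ge1$ be an integer and let $\mu$ be a centered probability measure on $\mathbb Z$ with $\mu([-T,T])=1$. Then there exists $\tau\in\mathcal T_T$ with $S_\tau\sim\mu$ if and only if $$U_\mu(x)\le\frac{U^\mu_{T-1}(x+1)+U^\mu_{T-1}(x-1)}{2},\qquad x=-(T-2),-(T-4),\dots,T-4,T-2.\tag{$*$}$$ (For $T=1$ condition $(*)$ is void.) Moreover, if $(*)$ holds, there exist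 a barrier $\mathbf b$ and $\mathbf r\in[0,1]^{\mathbb Z}$ such that families of coins for $(\mathbf b,\mathbf r)$ exist on $\Omega$ and, for every such family, $\tau_R(\mathbf b,\mathbf r)\in\mathcal T_T$ and $S_{\tau_R(\mathbf b,\mathbf r)}\sim\mu$. -/

import Mathlib

open MeasureTheory ProbabilityTheory

noncomputable section

namespace RootEmbedding

/-- A measure on the integers is a centered probability measure: total mass one, finite first
moment and mean zero. -/
structure IsCentered (μ : Measure ℤ) : Prop where
  isProb : IsProbabilityMeasure μ
  integrable : Integrable (fun y : ℤ => (y : ℝ)) μ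
  mean_zero : ∫ y : ℤ, (y : ℝ) ∂μ = 0

/-- The potential `U_μ(x) = ∫ |x - y| μ(dy)`. -/
def potential (μ : Measure ℤ) (x : ℝ) : ℝ := ∫ y : ℤ, |x - (y : ℝ)| ∂μ

/-- The evolutional functions `U_t^μ` at the integers. -/
def evol (μ : Measure ℤ) : ℕ → ℤ → ℝ
  | 0, x => |(x : ℝ)|
  | t + 1, x => min ((evol μ t (x - 1) + evol μ t (x + 1)) / 2) (potential μ x)

variable {Ω : Type*} {m : MeasurableSpace Ω}

/-- `S` is a standard symmetric random walk on the filtered probability space `(Ω, m, P; F)`: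
it is adapted, starts at zero, and each increment is independent of the past information `F t`
and equals `1` or `-1` with probability one half each. -/
structure IsSSRW (F : Filtration ℕ m) (P : Measure Ω) (S : ℕ → Ω → ℤ) : Prop where
  adapted : ∀ t, Measurable[F t] (S t)
  start : ∀ᵐ ω ∂P, S 0 ω = 0
  up : ∀ t, P {ω | S (t + 1) ω - S t ω = 1} = 1 / 2
  down : ∀ t, P {ω | S (t + 1) ω - S t ω = -1} = 1 / 2
  indep : ∀ t, Indep (MeasurableSpace.comap (fun ω => S (t + 1) ω - S t ω) ⊤) (F t) P

/-- The admissible class `𝒯_T`: stopping times of `F` with values in `[0, T]` almost surely. -/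
def Admissible (F : Filtration ℕ m) (P : Measure Ω) (T : ℕ) (τ : Ω → WithTop ℕ) : Prop :=
  IsStoppingTime F τ ∧ ∀ᵐ ω ∂P, τ ω ≤ (T : WithTop ℕ)

/-- `S_τ` has distribution `μ`. -/
def Embeds (P : Measure Ω) (S : ℕ → Ω → ℤ) (τ : Ω → WithTop ℕ) (μ : Measure ℤ) : Prop :=
  P.map (stoppedValue S τ) = μ

/-- A barrier `b`: for every integer `x`, `b x = x + 2 k ≥ |x|` for some integer `k`. -/
def IsBarrier (b : ℤ → ℤ) : Prop :=
  ∀ x, (∃ k : ℤ, b x = x + 2 * k) ∧ |x| ≤ b x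

/-- The probability of the value `0` ("stop") of the coin at the node `(t, x)`. -/
def stopProb (b : ℤ → ℤ) (r : ℤ → ℝ) (t : ℕ) (x : ℤ) : ℝ :=
  if (t : ℤ) < b x then 0 else if (t : ℤ) = b x then r x else 1

/-- A family of coins `ξ t x` with values `0` (stop) and `1` (continue), with the laws prescribed
by `(b, r)`, known at time `0`, mutually independent, and jointly independent of the walk `S`. -/
structure IsCoinFamily (F : Filtration ℕ m) (P : Measure Ω) (S : ℕ → Ω → ℤ)
    (b : ℤ → ℤ) (r : ℤ → ℝ) (ξ : ℕ → ℤ → Ω → Fin 2) : Prop where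
  measurable : ∀ t x, Measurable[F 0] (ξ t x)
  law : ∀ t x, P {ω | ξ t x ω = 0} = ENNReal.ofReal (stopProb b r t x)
  iIndep : iIndepFun (fun (p : ℕ × ℤ) => ξ p.1 p.2) P
  indep_walk : IndepFun (fun ω (p : ℕ × ℤ) => ξ p.1 p.2 ω) (fun ω (t : ℕ) => S t ω) P

/-- The randomized Root stopping time: the first time `t` at which `(t, S_t)` lies in the region
`{(t, x) | t ≥ b x}` and the coin at `(t, S_t)` shows `0` (infinite if there is no such time). -/
def rootTime (S : ℕ → Ω → ℤ) (b : ℤ → ℤ) (ξ : ℕ → ℤ → Ω → Fin 2) (ω : Ω) : WithTop ℕ :=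
  sInf ((fun t : ℕ => (t : WithTop ℕ)) '' {t : ℕ | b (S t ω) ≤ (t : ℤ) ∧ ξ t (S t ω) ω = 0})

end RootEmbedding

end

open RootEmbedding

namespace RootEmbedding

/-! For a stopping time `τ` let `p t x` be the mass of `{S_t = x, τ ≥ t}` and `q t x` that of `{S_t
= x, τ > t}`. The walk turns `q t` into `p (t + 1)` by averaging over neighbours, and `V t x = |x| +
∑ s < t, q s x` is the potential of the walk stopped at `τ ∧ t`; half its second difference is the
law of that stopped walk.

Necessity (`criterion_of_masses`): `V` increases in time to `V T = U_μ`, and `V (t + 1)` is at most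
the neighbour average of `V t`. Hence `V t ≤ evol μ t` by induction, and `U_μ = V T` is at most the
average of `V (T - 1)`, so at most that of `evol μ (T - 1)`.

Sufficiency: let `b x` be the first time of the right parity, not before `|x|`, at which the average
at `x` reaches `U_μ x`, and choose the coin there so that exactly `evol μ (t + 1) x - evol μ t x`
survives. By induction these increments are the surviving masses at all nodes
(`IsRootBarrier.alive_eq`). The criterion forces `evol μ T = evol μ (T + 1) = U_μ`
(`Criterion.evol_eq`): nothing survives time `T`, and the stopped masses sum to half the second
difference of `U_μ`, which is `μ` (`sum_masses_eq`).

Independence of each coin from the walk and the earlier coins links this calculus of masses with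
`rootTime`; the uniform variable serves only to construct coins. -/

/-- The second difference of the absolute value on the integers is twice the unit mass at zero. -/
theorem abs_sub_one_add_abs_add_one (x : ℤ) :
    |(x : ℝ) - 1| + |(x : ℝ) + 1| = 2 * |(x : ℝ)| + 2 * (if x = 0 then 1 else 0) := by
  rcases lt_trichotomy x 0 with h | h | h
  · have h1 : (x : ℝ) ≤ -1 := by exact_mod_cast (by omega : x ≤ -1)
    rw [if_neg h.ne, abs_of_nonpos (by linarith), abs_of_nonpos (by linarith),
      abs_of_nonpos (by linarith)]
    ring
  · subst h; norm_num
  · have h1 : (1 : ℝ) ≤ x := by exact_mod_cast (by omega : 1 ≤ x)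
    rw [if_neg h.ne', abs_of_nonneg (by linarith), abs_of_nonneg (by linarith),
      abs_of_nonneg (by linarith)]
    ring

theorem average_abs_of_ne_zero {x : ℤ} (hx : x ≠ 0) :
    (|((x - 1 : ℤ) : ℝ)| + |((x + 1 : ℤ) : ℝ)|) / 2 = |(x : ℝ)| := by
  have := abs_sub_one_add_abs_add_one x
  rw [if_neg hx] at this
  push_cast
  linarith

/-! ### Potentials of centered measures on the integers -/

section Potential

variable {μ : Measure ℤ}

theorem IsCentered.integrable_abs_sub (hμ : IsCentered μ) (x : ℝ) :
    Integrable (fun y : ℤ => |x - (y : ℝ)|) μ := by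
  have := hμ.isProb
  exact ((integrable_const x).sub hμ.integrable).abs

theorem IsCentered.integral_sub (hμ : IsCentered μ) (x : ℝ) :
    ∫ y : ℤ, (x - (y : ℝ)) ∂μ = x := by
  have := hμ.isProb
  rw [MeasureTheory.integral_sub (integrable_const x) hμ.integrable, hμ.mean_zero]
  simp

/-- Jensen's inequality: `x - y` has mean `x` under `μ`. -/
theorem IsCentered.abs_le_potential (hμ : IsCentered μ) (x : ℝ) : |x| ≤ potential μ x := by
  have := abs_integral_le_integral_abs (f := fun y : ℤ => x - (y : ℝ)) (μ := μ)
  rwa [hμ.integral_sub] at this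

/-- The second difference of the potential is twice the mass at the middle point. -/
theorem IsCentered.potential_second_difference (hμ : IsCentered μ) (x : ℤ) :
    potential μ ((x - 1 : ℤ) : ℝ) + potential μ ((x + 1 : ℤ) : ℝ)
      = 2 * potential μ x + 2 * μ.real {x} := by
  have := hμ.isProb
  have hpt : ∀ y : ℤ, |((x - 1 : ℤ) : ℝ) - y| + |((x + 1 : ℤ) : ℝ) - y|
      = 2 * |(x : ℝ) - y| + 2 * Set.indicator {x} 1 y := by
    intro y
    have h := abs_sub_one_add_abs_add_one (x - y)
    have e1 : ((x - 1 : ℤ) : ℝ) - y = ((x - y : ℤ) : ℝ) - 1 := by push_cast; ring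
    have e2 : ((x + 1 : ℤ) : ℝ) - y = ((x - y : ℤ) : ℝ) + 1 := by push_cast; ring
    rw [e1, e2, h]
    push_cast
    congr 2
    by_cases hxy : x = y
    · simp [hxy]
    · rw [if_neg (by omega), Set.indicator_of_notMem (by simpa using Ne.symm hxy)]
  unfold potential
  rw [← integral_add (hμ.integrable_abs_sub _) (hμ.integrable_abs_sub _)]
  simp_rw [hpt]
  have hi : Integrable (Set.indicator {x} (1 : ℤ → ℝ)) μ :=
    (integrable_const (1 : ℝ)).indicator (measurableSet_singleton x)
  rw [integral_add ((hμ.integrable_abs_sub _).const_mul 2) (hi.const_mul 2),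
    integral_const_mul, integral_const_mul]
  congr 2
  exact integral_indicator_one (measurableSet_singleton x)

/-- Outside an interval carrying the measure, the potential is the absolute value. -/
theorem IsCentered.potential_eq_abs (hμ : IsCentered μ) {T : ℕ}
    (hsupp : μ (Set.Icc (-(T : ℤ)) (T : ℤ)) = 1) {x : ℤ} (hx : (T : ℤ) ≤ |x|) :
    potential μ x = |(x : ℝ)| := by
  have := hμ.isProb
  have hae : ∀ᵐ y ∂μ, y ∈ Set.Icc (-(T : ℤ)) (T : ℤ) :=
    (prob_compl_eq_zero_iff (measurableSet_Icc)).2 hsupp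
  unfold potential
  rcases le_abs.1 hx with h | h
  · have h0 : (0 : ℤ) ≤ x := by omega
    rw [abs_of_nonneg (by exact_mod_cast h0 : (0 : ℝ) ≤ x), ← hμ.integral_sub (x : ℝ)]
    refine integral_congr_ae ?_
    filter_upwards [hae] with y hy
    -- Writing `x` as an integral also replaced the `x` inside the integrand; this restores it.
    rw [hμ.integral_sub]
    have : (y : ℝ) ≤ x := by exact_mod_cast hy.2.trans h
    exact abs_of_nonneg (by linarith)
  · have h0 : x ≤ (0 : ℤ) := by omega
    rw [abs_of_nonpos (by exact_mod_cast h0 : (x : ℝ) ≤ 0), ← hμ.integral_sub (x : ℝ),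
      ← integral_neg]
    refine integral_congr_ae ?_
    filter_upwards [hae] with y hy
    rw [hμ.integral_sub]
    have : (x : ℝ) ≤ y := by exact_mod_cast (by have := hy.1; omega : x ≤ y)
    exact abs_of_nonpos (by linarith)

end Potential

/-! ### Monotonicity, parity and finite propagation of the evolution -/

section Evol

variable {μ : Measure ℤ}

theorem evol_zero (μ : Measure ℤ) (x : ℤ) : evol μ 0 x = |(x : ℝ)| := rfl

theorem evol_succ (μ : Measure ℤ) (t : ℕ) (x : ℤ) :
    evol μ (t + 1) x = min ((evol μ t (x - 1) + evol μ t (x + 1)) / 2) (potential μ x) := rfl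

theorem evol_le_potential (hμ : IsCentered μ) (t : ℕ) (x : ℤ) : evol μ t x ≤ potential μ x := by
  cases t with
  | zero => exact hμ.abs_le_potential x
  | succ t => exact min_le_right _ _

theorem evol_succ_le_average (t : ℕ) (x : ℤ) :
    evol μ (t + 1) x ≤ (evol μ t (x - 1) + evol μ t (x + 1)) / 2 := min_le_left _ _

theorem evol_le_succ (hμ : IsCentered μ) (t : ℕ) (x : ℤ) : evol μ t x ≤ evol μ (t + 1) x := by
  induction t generalizing x with
  | zero =>
    refine le_min ?_ (hμ.abs_le_potential x)
    have := abs_sub_one_add_abs_add_one x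
    simp only [evol_zero]
    push_cast
    split_ifs at this <;> linarith
  | succ t ih =>
    refine le_min ((evol_succ_le_average t x).trans ?_) (evol_le_potential hμ _ x)
    linarith [ih (x - 1), ih (x + 1)]

theorem evol_mono (hμ : IsCentered μ) (x : ℤ) : Monotone fun t => evol μ t x :=
  monotone_nat_of_le_succ fun t => evol_le_succ hμ t x

theorem abs_le_evol (hμ : IsCentered μ) (t : ℕ) (x : ℤ) : |(x : ℝ)| ≤ evol μ t x :=
  evol_mono hμ x (Nat.zero_le t)

/-- The evolution does not change at nodes that the walk cannot visit for reasons of parity. -/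
theorem evol_succ_of_odd (hμ : IsCentered μ) (t : ℕ) (x : ℤ) (h : Odd (x - t)) :
    evol μ (t + 1) x = evol μ t x := by
  induction t generalizing x with
  | zero =>
    have hx : x ≠ 0 := by rintro rfl; simp at h
    rw [evol_succ]
    simp only [evol_zero]
    rw [average_abs_of_ne_zero hx]
    exact min_eq_left (hμ.abs_le_potential x)
  | succ t ih =>
    push_cast at h
    rw [evol_succ, ih (x - 1) (by convert! h using 1; ring),
      ih (x + 1) (by convert! h.add_even even_two using 1; ring), ← evol_succ]

/-- The kink of `|x|` at zero spreads by one site per step, and away from zero `|x|` equals its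
neighbour average. -/
theorem evol_eq_abs (hμ : IsCentered μ) {t : ℕ} {x : ℤ} (h : (t : ℤ) ≤ |x|) :
    evol μ t x = |(x : ℝ)| := by
  induction t generalizing x with
  | zero => rfl
  | succ t ih =>
    push_cast at h
    have hx : x ≠ 0 := by rintro rfl; simp at h; omega
    rw [evol_succ, ih (by grind), ih (by grind), average_abs_of_ne_zero hx]
    exact min_eq_left (hμ.abs_le_potential x)

end Evol

/-! ### The Root barrier and the masses surviving it -/

section Barrier

variable {μ : Measure ℤ}

/-- The potential is already reached at `x` by averaging at time `t`. -/
def Reached (μ : Measure ℤ) (t : ℕ) (x : ℤ) : Prop :=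
  potential μ x ≤ (evol μ t (x - 1) + evol μ t (x + 1)) / 2

theorem Reached.evol_succ_eq {t : ℕ} {x : ℤ} (h : Reached μ t x) :
    evol μ (t + 1) x = potential μ x := min_eq_right h

/-- Once attained, the potential is kept, since the evolution is nondecreasing in time and capped by
it. -/
theorem Reached.evol_eq_of_lt (hμ : IsCentered μ) {t s : ℕ} {x : ℤ} (h : Reached μ t x)
    (hs : t < s) : evol μ s x = potential μ x :=
  (evol_le_potential hμ s x).antisymm (h.evol_succ_eq ▸ evol_mono hμ x hs)

theorem evol_succ_eq_average {t : ℕ} {x : ℤ} (h : ¬ Reached μ t x) :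
    evol μ (t + 1) x = (evol μ t (x - 1) + evol μ t (x + 1)) / 2 :=
  min_eq_left (not_le.1 h).le

/-- The first time of the right parity, not before `|x|`, at which the potential is reached. -/
structure IsRootBarrier (μ : Measure ℤ) (b : ℤ → ℕ) : Prop where
  even : ∀ x, Even (x - b x)
  abs_le : ∀ x, |x| ≤ b x
  reached : ∀ x, Reached μ (b x) x
  minimal : ∀ (x : ℤ) (t : ℕ), Even (x - (t : ℤ)) → |x| ≤ t → t < b x → ¬ Reached μ t x

theorem exists_isRootBarrier (h : ∀ x : ℤ, ∃ t : ℕ, Even (x - (t : ℤ)) ∧ |x| ≤ t ∧ Reached μ t x) :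
    ∃ b, IsRootBarrier μ b := by
  classical
  refine ⟨fun x => Nat.find (h x), fun x => (Nat.find_spec (h x)).1,
    fun x => (Nat.find_spec (h x)).2.1, fun x => (Nat.find_spec (h x)).2.2, ?_⟩
  intro x t h1 h2 h3 h4
  exact Nat.find_min (h x) h3 ⟨h1, h2, h4⟩

variable {b : ℤ → ℕ}

/-- Before the barrier the evolution is that of the free walk, at all nodes. -/
theorem IsRootBarrier.evol_succ_eq_average (hμ : IsCentered μ) (hb : IsRootBarrier μ b)
    {t : ℕ} {x : ℤ} (ht : t < b x) :
    evol μ (t + 1) x = (evol μ t (x - 1) + evol μ t (x + 1)) / 2 := by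
  rcases lt_or_ge (t : ℤ) |x| with hlt | hge
  · have hx : x ≠ 0 := by rintro rfl; simp at hlt; omega
    rw [evol_eq_abs hμ (by push_cast; omega), evol_eq_abs hμ (by grind), evol_eq_abs hμ (by grind),
      average_abs_of_ne_zero hx]
  rcases Int.even_or_odd (x - t) with he | ho
  · exact RootEmbedding.evol_succ_eq_average (hb.minimal x t he hge ht)
  -- At the wrong parity the value at `x` is frozen during this step, and those at `x ± 1` were
  -- frozen during the previous one, so the identity is that of one step earlier, where minimality
  -- of `b x` applies.
  rw [evol_succ_of_odd hμ t x ho]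
  cases t with
  | zero =>
    have : x = 0 := by simpa using hge
    subst this; simp at ho
  | succ t =>
    push_cast at ho hge
    have he : Even (x - t) := by convert! ho.add_one using 1; ring
    have hge' : |x| ≤ t := by
      -- Parity rules out `|x| = t + 1`, so the earlier time is still not before `|x|`.
      rcases hge.eq_or_lt with h | h
      · exfalso
        rcases abs_choice x with h' | h' <;> rw [h'] at h <;> grind
      · omega
    rw [RootEmbedding.evol_succ_eq_average (hb.minimal x t he hge' (by omega)),
      evol_succ_of_odd hμ t (x - 1) (by convert! he.sub_odd odd_one using 1; ring),
      evol_succ_of_odd hμ t (x + 1) (by convert! he.add_odd odd_one using 1; ring)]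

/-- The stopping probabilities on the barrier. -/
noncomputable def barrierProb (μ : Measure ℤ) (b : ℤ → ℕ) (x : ℤ) : ℝ :=
  1 - (potential μ x - evol μ (b x) x) /
    ((evol μ (b x) (x - 1) + evol μ (b x) (x + 1)) / 2 - evol μ (b x) x)

theorem IsRootBarrier.barrierProb_mem (hμ : IsCentered μ) (hb : IsRootBarrier μ b) (x : ℤ) :
    barrierProb μ b x ∈ Set.Icc (0 : ℝ) 1 := by
  have h1 := evol_le_potential hμ (b x) x
  have h2 : potential μ x ≤ _ := hb.reached x
  have h3 := div_nonneg (sub_nonneg.2 h1) (sub_nonneg.2 (h1.trans h2))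
  have h4 := div_le_one_of_le₀ (sub_le_sub_right h2 (evol μ (b x) x))
    (sub_nonneg.2 (h1.trans h2))
  exact ⟨sub_nonneg.2 h4, sub_le_self _ h3⟩

theorem IsRootBarrier.isBarrier (hb : IsRootBarrier μ b) : IsBarrier fun x => (b x : ℤ) := by
  intro x
  obtain ⟨k, hk⟩ := hb.even x
  exact ⟨⟨-k, by show (b x : ℤ) = _; omega⟩, hb.abs_le x⟩

/-- The masses that stay alive under the randomized Root rule are the increments of the
evolution. -/
theorem IsRootBarrier.alive_eq (hμ : IsCentered μ) (hb : IsRootBarrier μ b)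
    {p q : ℕ → ℤ → ℝ} (h0 : ∀ x, p 0 x = if x = 0 then 1 else 0)
    (hp : ∀ t x, p (t + 1) x = (q t (x - 1) + q t (x + 1)) / 2)
    (hq : ∀ t x, q t x = p t x * (1 - stopProb (fun x => (b x : ℤ)) (barrierProb μ b) t x))
    (t : ℕ) (x : ℤ) : q t x = evol μ (t + 1) x - evol μ t x := by
  -- The formula for `p` is needed only up to the barrier: beyond it every coin stops and the
  -- evolution is constant in time.
  have step : ∀ t, (∀ x, t ≤ b x →
      p t x = (evol μ t (x - 1) + evol μ t (x + 1)) / 2 - evol μ t x) →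
      ∀ x, q t x = evol μ (t + 1) x - evol μ t x := by
    intro t h x
    rw [hq]
    unfold stopProb
    rcases lt_trichotomy t (b x) with hlt | heq | hgt
    · rw [if_pos (Nat.cast_lt.2 hlt), h x hlt.le, hb.evol_succ_eq_average hμ hlt]
      ring
    · rw [if_neg (by simp [heq]), if_pos (by simp [heq]), h x heq.le]
      subst heq
      rw [(hb.reached x).evol_succ_eq, barrierProb, sub_sub_cancel]
      have h1 := evol_le_potential hμ (b x) x
      have h2 : potential μ x ≤ _ := hb.reached x
      -- If no mass arrives, the quotient in `barrierProb` has denominator zero. Its conventional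
      -- value is harmless, as the potential is then squeezed to equal the evolution.
      by_cases hz : (evol μ (b x) (x - 1) + evol μ (b x) (x + 1)) / 2 - evol μ (b x) x = 0
      · rw [hz]
        linarith
      · exact mul_div_cancel₀ _ hz
    · rw [if_neg (by push_cast; omega), if_neg (by push_cast; omega),
        (hb.reached x).evol_eq_of_lt hμ hgt, (hb.reached x).evol_eq_of_lt hμ (hgt.trans t.lt_succ_self)]
      ring
  induction t generalizing x with
  | zero =>
    refine step 0 (fun x _ => ?_) x
    have := abs_sub_one_add_abs_add_one x
    rw [h0]
    simp only [evol_zero]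
    push_cast
    linarith
  | succ t ih =>
    refine step (t + 1) (fun x hx => ?_) x
    rw [hp, ih, ih, hb.evol_succ_eq_average hμ hx]
    ring

end Barrier

/-! ### Consequences of the criterion -/

section Criterion

variable {μ : Measure ℤ} {T : ℕ}

/-- The criterion for embedding by time `T`, at the nodes of the parity of `T`. -/
def Criterion (μ : Measure ℤ) (T : ℕ) : Prop :=
  ∀ x : ℤ, -((T : ℤ) - 2) ≤ x → x ≤ (T : ℤ) - 2 → Even (x - (T : ℤ)) →
    potential μ x ≤ (evol μ (T - 1) (x + 1) + evol μ (T - 1) (x - 1)) / 2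

/-- Parity excludes `|x| = T - 1`, so the nodes not covered by the criterion have `|x| ≥ T`. There
the potential is `|x|`, the neighbour average of the absolute value, which bounds the evolution from
below. -/
theorem Criterion.reached (hT : 1 ≤ T) (hμ : IsCentered μ)
    (hsupp : μ (Set.Icc (-(T : ℤ)) (T : ℤ)) = 1) (h : Criterion μ T) {x : ℤ}
    (hx : Even (x - (T : ℤ))) : Reached μ (T - 1) x := by
  by_cases hin : |x| ≤ (T : ℤ) - 2
  · have := h x (by grind) (by grind) hx
    rwa [add_comm] at this
  · have hge : (T : ℤ) ≤ |x| := by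
      by_contra hlt
      rcases abs_choice x with h' | h' <;> grind
    have hx0 : x ≠ 0 := by rintro rfl; simp at hge; omega
    unfold Reached
    rw [hμ.potential_eq_abs hsupp hge, ← average_abs_of_ne_zero hx0]
    linarith [abs_le_evol hμ (T - 1) (x - 1), abs_le_evol hμ (T - 1) (x + 1)]

/-- Under the criterion the evolution reaches the potential at time `T`. -/
theorem Criterion.evol_eq (hT : 1 ≤ T) (hμ : IsCentered μ)
    (hsupp : μ (Set.Icc (-(T : ℤ)) (T : ℤ)) = 1) (h : Criterion μ T) (x : ℤ) :
    evol μ T x = potential μ x ∧ evol μ (T + 1) x = potential μ x := by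
  have even {x : ℤ} (hx : Even (x - (T : ℤ))) {t : ℕ} (ht : T ≤ t) : evol μ t x = potential μ x :=
    (h.reached hT hμ hsupp hx).evol_eq_of_lt hμ (by omega)
  rcases Int.even_or_odd (x - T) with he | ho
  · exact ⟨even he le_rfl, even he (Nat.le_succ T)⟩
  -- Both neighbours have the parity of `T` and carry the potential already. Convexity of the
  -- potential makes the minimum equal to it at time `T + 1`, and parity carries this back to `T`.
  · have h1 : evol μ (T + 1) x = potential μ x := by
      rw [evol_succ, even (by convert! ho.sub_odd odd_one using 1; ring) le_rfl,
        even (by convert! ho.add_odd odd_one using 1; ring) le_rfl, hμ.potential_second_difference]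
      exact min_eq_right (by linarith [measureReal_nonneg (μ := μ) (s := {x})])
    exact ⟨evol_succ_of_odd hμ T x ho ▸ h1, h1⟩

theorem Criterion.exists_isRootBarrier (hT : 1 ≤ T) (hμ : IsCentered μ)
    (hsupp : μ (Set.Icc (-(T : ℤ)) (T : ℤ)) = 1) (h : Criterion μ T) :
    ∃ b, IsRootBarrier μ b := by
  refine RootEmbedding.exists_isRootBarrier fun x => ?_
  have key : ∀ t : ℕ, T ≤ t → Reached μ t x := by
    intro t ht
    unfold Reached
    have h1 := hμ.potential_second_difference x
    have h2 := fun y => ((h.evol_eq hT hμ hsupp y).1.symm.le.trans (evol_mono hμ y ht))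
    linarith [h2 (x - 1), h2 (x + 1), measureReal_nonneg (μ := μ) (s := {x})]
  -- Any time that has the parity of `x` and is at least `|x|` and `T` would do.
  refine ⟨x.natAbs + 2 * T, ?_, by push_cast; omega, key _ (by omega)⟩
  rcases Int.natAbs_eq x with h' | h' <;> grind

end Criterion

/-! ### From masses to potentials and back -/

section Uniqueness

/-- Two functions on the integers with the same second differences that agree far out on the left
are equal. -/
theorem eq_of_second_difference_eq {f g : ℤ → ℝ} {N : ℤ}
    (h : ∀ x, f (x - 1) + f (x + 1) - 2 * f x = g (x - 1) + g (x + 1) - 2 * g x)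
    (hN : ∀ x ≤ N, f x = g x) (x : ℤ) : f x = g x := by
  have key : ∀ n : ℕ, ∀ x ≤ N + n, f x = g x := by
    intro n
    induction n with
    | zero => simpa using hN
    | succ n ih =>
      intro x hx
      push_cast at hx
      have h1 := h (x - 1)
      rw [ih (x - 1) (by omega), ih (x - 1 - 1) (by omega), sub_add_cancel] at h1
      linarith
  exact key (x - N).toNat x (by omega)

/-- If the masses `q` that survive are dominated by the masses `p` that arrive, the potentials
they generate are dominated by the evolution. -/
theorem criterion_of_masses {μ : Measure ℤ} {T : ℕ} (hT : 1 ≤ T) (hμ : IsCentered μ)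
    (hsupp : μ (Set.Icc (-(T : ℤ)) (T : ℤ)) = 1)
    {p q : ℕ → ℤ → ℝ} (h0 : ∀ x, p 0 x = if x = 0 then 1 else 0)
    (hp : ∀ t x, p (t + 1) x = (q t (x - 1) + q t (x + 1)) / 2)
    (hq0 : ∀ t x, 0 ≤ q t x) (hqp : ∀ t x, q t x ≤ p t x) (hqT : ∀ x, q T x = 0)
    (hlaw : ∀ x, μ.real {x} = ∑ t ∈ Finset.range (T + 1), (p t x - q t x)) (x : ℤ) :
    potential μ x ≤ (evol μ (T - 1) (x + 1) + evol μ (T - 1) (x - 1)) / 2 := by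
  -- `V t` plays the potential of the walk stopped at `τ ∧ t`; the bracket in `hVd` is the law of
  -- that stopped walk.
  let V : ℕ → ℤ → ℝ := fun t x => |(x : ℝ)| + ∑ s ∈ Finset.range t, q s x
  have hVs : ∀ t x, V (t + 1) x = V t x + q t x := fun t x => by
    simp only [V, Finset.sum_range_succ]; ring
  have hVd : ∀ t x, V t (x - 1) + V t (x + 1)
      = 2 * V t x + 2 * (p t x + ∑ s ∈ Finset.range t, (p s x - q s x)) := by
    intro t x
    induction t with
    | zero =>
      have := abs_sub_one_add_abs_add_one x
      simp only [V, Finset.range_zero, Finset.sum_empty, h0]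
      push_cast
      linarith
    | succ t ih => rw [hVs, hVs, hVs, hp, Finset.sum_range_succ]; linarith
  have hVavg : ∀ t x, V (t + 1) x ≤ (V t (x - 1) + V t (x + 1)) / 2 := by
    intro t x
    have : 0 ≤ ∑ s ∈ Finset.range t, (p s x - q s x) :=
      Finset.sum_nonneg fun s _ => sub_nonneg.2 (hqp s x)
    linarith [hVs t x, hVd t x, hqp t x]
  have hfar : ∀ (t : ℕ) (x : ℤ), (t : ℤ) < |x| → p t x = 0 ∧ q t x = 0 := by
    intro t
    induction t with
    | zero =>
      intro x hx
      have h1 : p 0 x = 0 := by rw [h0, if_neg (by rintro rfl; simp at hx)]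
      exact ⟨h1, le_antisymm (h1 ▸ hqp 0 x) (hq0 0 x)⟩
    | succ t ih =>
      intro x hx
      push_cast at hx
      have h1 : p (t + 1) x = 0 := by
        rw [hp, (ih (x - 1) (by grind)).2, (ih (x + 1) (by grind)).2]; norm_num
      exact ⟨h1, le_antisymm (h1 ▸ hqp _ x) (hq0 _ x)⟩
  -- As `q T = 0`, the law hypothesis makes the second differences agree; to the left of `-T` both
  -- sides are `|x|`, since no mass travels faster than the walk.
  have hVT : ∀ x, V T x = potential μ x := by
    refine eq_of_second_difference_eq (N := -(T : ℤ)) (fun x => ?_) (fun x hx => ?_)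
    · have h1 := hlaw x
      rw [Finset.sum_range_succ, hqT] at h1
      linarith [hVd T x, hμ.potential_second_difference x]
    · have hx' : (T : ℤ) ≤ |x| := by grind
      rw [hμ.potential_eq_abs hsupp hx']
      simp only [V]
      rw [Finset.sum_eq_zero, add_zero]
      intro s hs
      rw [Finset.mem_range] at hs
      exact (hfar s x (by omega)).2
  have hVmono : ∀ x, Monotone fun t => V t x := fun x =>
    monotone_nat_of_le_succ fun t => by linarith [hVs t x, hq0 t x]
  have hle : ∀ t ≤ T, ∀ x, V t x ≤ evol μ t x := by
    intro t
    induction t with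
    | zero => intro _ x; simp [V, evol_zero]
    | succ t ih =>
      intro ht x
      refine le_min ((hVavg t x).trans ?_) (hVT x ▸ hVmono x ht)
      linarith [ih (by omega) (x - 1), ih (by omega) (x + 1)]
  obtain ⟨n, rfl⟩ : ∃ n, T = n + 1 := ⟨T - 1, by omega⟩
  rw [← hVT, Nat.add_sub_cancel]
  linarith [hVavg n x, hle n (by omega) (x - 1), hle n (by omega) (x + 1)]

/-- The law produced by surviving masses that follow the evolution. -/
theorem sum_masses_eq {μ : Measure ℤ} (hμ : IsCentered μ) {T : ℕ}
    {p q : ℕ → ℤ → ℝ} (h0 : ∀ x, p 0 x = if x = 0 then 1 else 0)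
    (hp : ∀ t x, p (t + 1) x = (q t (x - 1) + q t (x + 1)) / 2)
    (hq : ∀ t x, q t x = evol μ (t + 1) x - evol μ t x)
    (hT : ∀ x, evol μ T x = potential μ x ∧ evol μ (T + 1) x = potential μ x) (x : ℤ) :
    ∑ t ∈ Finset.range (T + 1), (p t x - q t x) = μ.real {x} := by
  -- Half the second difference of `evol μ t` is the law of the walk stopped at `τ ∧ t`; removing
  -- the part still alive leaves what has stopped by time `t`.
  have key : ∀ t, ∑ s ∈ Finset.range (t + 1), (p s x - q s x)
      = (evol μ t (x - 1) + evol μ t (x + 1)) / 2 - evol μ t x - q t x := by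
    intro t
    induction t with
    | zero =>
      have := abs_sub_one_add_abs_add_one x
      simp only [zero_add, Finset.sum_range_one, h0, evol_zero]
      push_cast
      linarith
    | succ t ih => rw [Finset.sum_range_succ, ih, hp, hq t, hq t, hq t]; ring
  rw [key, hq, (hT _).1, (hT _).1, (hT _).1, (hT _).2]
  linarith [hμ.potential_second_difference x]

end Uniqueness

end RootEmbedding

namespace RootEmbedding

variable {Ω : Type*} {m : MeasurableSpace Ω} {P : Measure Ω} {F : Filtration ℕ m}
  {S : ℕ → Ω → ℤ} {τ : Ω → WithTop ℕ}

/-! ### Arriving and surviving masses of a stopping time -/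

section Masses

/-- The mass arriving at the node `(t, x)` not stopped before `t`. -/
noncomputable def arrive (P : Measure Ω) (S : ℕ → Ω → ℤ) (τ : Ω → WithTop ℕ) (t : ℕ) (x : ℤ) : ℝ :=
  P.real {ω | S t ω = x ∧ (t : WithTop ℕ) ≤ τ ω}

/-- The mass leaving the node `(t, x)` not stopped at or before `t`. -/
noncomputable def alive (P : Measure Ω) (S : ℕ → Ω → ℤ) (τ : Ω → WithTop ℕ) (t : ℕ) (x : ℤ) : ℝ :=
  P.real {ω | S t ω = x ∧ (t : WithTop ℕ) < τ ω}

theorem coe_succ_le_iff {t : ℕ} {a : WithTop ℕ} :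
    ((t + 1 : ℕ) : WithTop ℕ) ≤ a ↔ (t : WithTop ℕ) < a := by
  cases a with
  | top => simp
  | coe n => exact WithTop.coe_le_coe.trans (Nat.succ_le_iff.trans WithTop.coe_lt_coe.symm)

theorem IsSSRW.measurable (hS : IsSSRW F P S) (t : ℕ) : Measurable (S t) :=
  (hS.adapted t).mono (F.le t) le_rfl

theorem alive_nonneg (t : ℕ) (x : ℤ) : 0 ≤ alive P S τ t x := measureReal_nonneg

theorem alive_le_arrive [IsFiniteMeasure P] (t : ℕ) (x : ℤ) :
    alive P S τ t x ≤ arrive P S τ t x :=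
  measureReal_mono fun _ h => ⟨h.1, h.2.le⟩

theorem IsSSRW.arrive_zero [IsProbabilityMeasure P] (hS : IsSSRW F P S) (x : ℤ) :
    arrive P S τ 0 x = if x = 0 then 1 else 0 := by
  have h : ∀ᵐ ω ∂P, (ω ∈ {ω | S 0 ω = x ∧ ((0 : ℕ) : WithTop ℕ) ≤ τ ω} ↔ ω ∈ {_ω : Ω | x = 0}) := by
    filter_upwards [hS.start] with ω hω
    simp [hω, eq_comm]
  rw [arrive, measureReal_congr (Filter.eventuallyEq_set.2 h)]
  split_ifs with hx <;> simp [hx]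

theorem IsSSRW.increment (hS : IsSSRW F P S) [IsProbabilityMeasure P] (t : ℕ) :
    ∀ᵐ ω ∂P, S (t + 1) ω = S t ω + 1 ∨ S (t + 1) ω = S t ω - 1 := by
  have hmeas : Measurable fun ω => S (t + 1) ω - S t ω :=
    (hS.measurable (t + 1)).sub (hS.measurable t)
  have h : P ({ω | S (t + 1) ω - S t ω = 1} ∪ {ω | S (t + 1) ω - S t ω = -1}) = 1 := by
    have hd : Disjoint {ω | S (t + 1) ω - S t ω = 1} {ω | S (t + 1) ω - S t ω = -1} :=
      Set.disjoint_left.2 fun ω (h1 : _ = _) (h2 : _ = _) => by omega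
    rw [measure_union hd (hmeas (measurableSet_singleton (-1)) :), hS.up, hS.down]
    exact ENNReal.add_halves 1
  have h' := (prob_compl_eq_zero_iff ((hmeas (measurableSet_singleton 1)).union
    (hmeas (measurableSet_singleton (-1))))).2 h
  filter_upwards [mem_ae_iff.2 h'] with ω hω
  rcases hω with h | h
  · exact Or.inl (by have h' : S (t + 1) ω - S t ω = 1 := h; omega)
  · exact Or.inr (by have h' : S (t + 1) ω - S t ω = -1 := h; omega)

theorem IsSSRW.measurableSet_alive (hS : IsSSRW F P S) (hτ : IsStoppingTime F τ) (t : ℕ) (x : ℤ) :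
    MeasurableSet[F t] {ω | S t ω = x ∧ (t : WithTop ℕ) < τ ω} :=
  (hS.adapted t (measurableSet_singleton x)).inter (hτ.measurableSet_gt t)

/-- The event `{S_t = y, τ > t}` belongs to `F t`, hence is independent of the next increment, which
sends half of its mass each way. -/
theorem IsSSRW.arrive_succ [IsProbabilityMeasure P] (hS : IsSSRW F P S) (hτ : IsStoppingTime F τ)
    (t : ℕ) (x : ℤ) :
    arrive P S τ (t + 1) x = (alive P S τ t (x - 1) + alive P S τ t (x + 1)) / 2 := by
  have half : ∀ (y d : ℤ), P {ω | S (t + 1) ω - S t ω = d} = 1 / 2 →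
      P.real ({ω | S (t + 1) ω - S t ω = d} ∩ {ω | S t ω = y ∧ (t : WithTop ℕ) < τ ω})
        = alive P S τ t y / 2 := by
    intro y d hd
    have := ((Indep_iff _ _ _).1 (hS.indep t)) {ω | S (t + 1) ω - S t ω = d}
      {ω | S t ω = y ∧ (t : WithTop ℕ) < τ ω} ⟨{d}, trivial, rfl⟩ (hS.measurableSet_alive hτ t y)
    rw [measureReal_def, this, hd, ENNReal.toReal_mul, alive, measureReal_def]
    norm_num
    ring
  have hae : ∀ᵐ ω ∂P, (ω ∈ {ω | S (t + 1) ω = x ∧ ((t + 1 : ℕ) : WithTop ℕ) ≤ τ ω} ↔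
      ω ∈ ({ω | S (t + 1) ω - S t ω = 1} ∩ {ω | S t ω = x - 1 ∧ (t : WithTop ℕ) < τ ω}) ∪
        ({ω | S (t + 1) ω - S t ω = -1} ∩ {ω | S t ω = x + 1 ∧ (t : WithTop ℕ) < τ ω})) := by
    filter_upwards [hS.increment t] with ω hω
    simp only [Set.mem_union, Set.mem_inter_iff, Set.mem_ofPred_eq, coe_succ_le_iff]
    by_cases h : (t : WithTop ℕ) < τ ω
    · simp only [h, and_true]
      omega
    · simp [h]
  have hmeas : Measurable fun ω => S (t + 1) ω - S t ω :=
    (hS.measurable (t + 1)).sub (hS.measurable t)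
  rw [arrive, measureReal_congr (Filter.eventuallyEq_set.2 hae), measureReal_union,
    half _ _ (hS.up t), half _ _ (hS.down t)]
  · ring
  · exact Set.disjoint_left.2 fun ω h1 h2 => by
      have h3 : _ = _ := h1.1
      have h4 : _ = _ := h2.1
      omega
  · exact (hmeas (measurableSet_singleton (-1))).inter
      (F.le t _ (hS.measurableSet_alive hτ t (x + 1)))

theorem IsSSRW.arrive_sub_alive [IsFiniteMeasure P] (hS : IsSSRW F P S) (hτ : IsStoppingTime F τ)
    (t : ℕ) (x : ℤ) :
    arrive P S τ t x - alive P S τ t x = P.real {ω | S t ω = x ∧ τ ω = t} := by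
  have h : {ω | S t ω = x ∧ τ ω = t}
      = {ω | S t ω = x ∧ (t : WithTop ℕ) ≤ τ ω} \ {ω | S t ω = x ∧ (t : WithTop ℕ) < τ ω} := by
    ext ω
    simp only [Set.mem_sdiff, Set.mem_ofPred_eq, not_and, not_lt]
    constructor
    · rintro ⟨h1, h2⟩
      exact ⟨⟨h1, h2.ge⟩, fun _ => h2.le⟩
    · rintro ⟨⟨h1, h2⟩, h3⟩
      exact ⟨h1, (h3 h1).antisymm h2⟩
  rw [h, measureReal_sdiff (s₁ := {ω | S t ω = x ∧ (t : WithTop ℕ) ≤ τ ω}) (fun ω h => ⟨h.1, h.2.le⟩) (F.le t _ (hS.measurableSet_alive hτ t x))]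
  rfl

/-- Where `τ` is infinite, `untopA` supplies a fixed arbitrary time, so measurability needs no
finiteness of `τ`. -/
theorem IsSSRW.measurable_stoppedValue (hS : IsSSRW F P S) (hτ : IsStoppingTime F τ) :
    Measurable (stoppedValue S τ) := by
  have hmeas : Measurable τ := hτ.measurable'
  have h : Measurable fun p : Ω × ℕ => S p.2 p.1 :=
    measurable_from_prod_countable_left fun t => hS.measurable t
  have h2 : Measurable fun ω => (τ ω).untopA :=
    (measurable_of_countable (WithTop.untopA : WithTop ℕ → ℕ)).comp hmeas
  exact h.comp (measurable_id.prodMk h2)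

theorem IsSSRW.measureReal_stoppedValue [IsFiniteMeasure P] (hS : IsSSRW F P S) {T : ℕ}
    (hτ : Admissible F P T τ) (x : ℤ) :
    P.real {ω | stoppedValue S τ ω = x}
      = ∑ t ∈ Finset.range (T + 1), (arrive P S τ t x - alive P S τ t x) := by
  have hae : ∀ᵐ ω ∂P, (ω ∈ {ω | stoppedValue S τ ω = x} ↔
      ω ∈ ⋃ t ∈ Finset.range (T + 1), {ω | S t ω = x ∧ τ ω = t}) := by
    filter_upwards [hτ.2] with ω hω
    simp only [Set.mem_iUnion, Set.mem_ofPred_eq, Finset.mem_range, exists_prop, stoppedValue]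
    obtain ⟨n, hn⟩ := WithTop.ne_top_iff_exists.1 (ne_top_of_le_ne_top WithTop.coe_ne_top hω)
    rw [← hn] at hω ⊢
    change S n ω = x ↔ _
    have hn' : n ≤ T := WithTop.coe_le_coe.1 hω
    constructor
    · exact fun h => ⟨n, by omega, h, rfl⟩
    · rintro ⟨t, -, h1, h2⟩
      rwa [WithTop.coe_injective h2]
  rw [measureReal_congr (Filter.eventuallyEq_set.2 hae), measureReal_biUnion_finset]
  · exact Finset.sum_congr rfl fun t _ => (hS.arrive_sub_alive hτ.1 t x).symm
  · intro s _ t _ hst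
    refine Set.disjoint_left.2 fun ω h1 h2 => hst ?_
    exact WithTop.coe_injective (h1.2.symm.trans h2.2)
  · intro t _
    exact F.le t _ ((hS.adapted t (measurableSet_singleton x)).inter (hτ.1.measurableSet_eq t))

theorem Admissible.alive_eq_zero {T : ℕ} (hτ : Admissible F P T τ) (x : ℤ) :
    alive P S τ T x = 0 := by
  have h : P {ω | S T ω = x ∧ (T : WithTop ℕ) < τ ω} = 0 :=
    measure_mono_null (fun ω h => not_le.2 h.2) hτ.2
  rw [alive, measureReal_def, h, ENNReal.toReal_zero]

theorem admissible_of_alive_eq_zero [IsFiniteMeasure P] {T : ℕ} (hτ : IsStoppingTime F τ)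
    (h : ∀ x, alive P S τ T x = 0) : Admissible F P T τ := by
  refine ⟨hτ, ?_⟩
  have h' : ∀ᵐ ω ∂P, ∀ x, ¬ (S T ω = x ∧ (T : WithTop ℕ) < τ ω) := by
    refine ae_all_iff.2 fun x => ?_
    have := (measureReal_eq_zero_iff).1 (h x)
    rw [ae_iff]
    simpa using this
  filter_upwards [h'] with ω hω
  exact not_lt.1 fun hlt => hω _ ⟨rfl, hlt⟩

/-- An admissible embedding forces the criterion. -/
theorem IsSSRW.criterion_of_embeds [IsProbabilityMeasure P] (hS : IsSSRW F P S) {T : ℕ}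
    (hT : 1 ≤ T) {μ : Measure ℤ} (hμ : IsCentered μ)
    (hsupp : μ (Set.Icc (-(T : ℤ)) (T : ℤ)) = 1) (hτ : Admissible F P T τ)
    (he : Embeds P S τ μ) : Criterion μ T := by
  intro x _ _ _
  refine criterion_of_masses hT hμ hsupp (p := arrive P S τ) (q := alive P S τ) hS.arrive_zero
    (hS.arrive_succ hτ.1) alive_nonneg alive_le_arrive hτ.alive_eq_zero (fun y => ?_) x
  rw [← hS.measureReal_stoppedValue hτ, ← he,
    map_measureReal_apply (hS.measurable_stoppedValue hτ.1) (measurableSet_singleton y)]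
  rfl

/-- A stopping time whose surviving masses follow an evolution reaching the potential embeds. -/
theorem IsSSRW.embeds_of_alive [IsProbabilityMeasure P] (hS : IsSSRW F P S) {T : ℕ}
    {μ : Measure ℤ} (hμ : IsCentered μ) (hτ : IsStoppingTime F τ)
    (hq : ∀ t x, alive P S τ t x = evol μ (t + 1) x - evol μ t x)
    (hU : ∀ x, evol μ T x = potential μ x ∧ evol μ (T + 1) x = potential μ x) :
    Admissible F P T τ ∧ Embeds P S τ μ := by
  have := hμ.isProb
  -- The bound by `T` comes from the evolution being stationary between `T` and `T + 1`, without any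
  -- bound on the barrier.
  have hadm : Admissible F P T τ := admissible_of_alive_eq_zero (S := S) hτ fun x => by
    rw [hq, (hU x).1, (hU x).2, sub_self]
  refine ⟨hadm, ?_⟩
  have hm := hS.measurable_stoppedValue hτ
  have := Measure.isProbabilityMeasure_map (μ := P) hm.aemeasurable
  refine Measure.ext_of_singleton fun x => ?_
  rw [← ENNReal.toReal_eq_toReal_iff' (measure_ne_top _ _) (measure_ne_top _ _)]
  change (P.map (stoppedValue S τ)).real {x} = μ.real {x}
  rw [map_measureReal_apply hm (measurableSet_singleton x)]
  exact (hS.measureReal_stoppedValue hadm x).trans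
    (sum_masses_eq hμ hS.arrive_zero (hS.arrive_succ hτ) hq hU x)

end Masses

end RootEmbedding

namespace RootEmbedding

variable {Ω : Type*} {m : MeasurableSpace Ω} {P : Measure Ω} {F : Filtration ℕ m}
  {S : ℕ → Ω → ℤ} {b : ℤ → ℤ} {r : ℤ → ℝ} {ξ : ℕ → ℤ → Ω → Fin 2}

theorem stopProb_mem (hr : ∀ x, r x ∈ Set.Icc (0 : ℝ) 1) (t : ℕ) (x : ℤ) :
    stopProb b r t x ∈ Set.Icc (0 : ℝ) 1 := by
  unfold stopProb
  split_ifs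
  · simp
  · exact hr x
  · simp

/-! ### The Root time as a stopping time -/

section RootTime

theorem coe_le_rootTime_iff {t : ℕ} {ω : Ω} :
    (t : WithTop ℕ) ≤ rootTime S b ξ ω ↔
      ∀ s < t, ¬ (b (S s ω) ≤ (s : ℤ) ∧ ξ s (S s ω) ω = 0) := by
  rw [rootTime, le_sInf_iff]
  constructor
  · intro h s hs hc
    exact absurd (WithTop.coe_le_coe.1 (h _ ⟨s, hc, rfl⟩)) (not_le.2 hs)
  · rintro h _ ⟨s, hs, rfl⟩
    exact WithTop.coe_le_coe.2 (not_lt.1 fun hlt => h s hlt hs)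

theorem coe_lt_rootTime_iff {t : ℕ} {ω : Ω} :
    (t : WithTop ℕ) < rootTime S b ξ ω ↔
      (t : WithTop ℕ) ≤ rootTime S b ξ ω ∧ ¬ (b (S t ω) ≤ (t : ℤ) ∧ ξ t (S t ω) ω = 0) := by
  rw [← coe_succ_le_iff, coe_le_rootTime_iff, coe_le_rootTime_iff]
  exact Nat.forall_lt_succ_right

theorem IsCoinFamily.isStoppingTime (hS : IsSSRW F P S) (hc : IsCoinFamily F P S b r ξ) :
    IsStoppingTime F (rootTime S b ξ) := by
  intro t
  -- Splitting over the position `y` replaces the coin at a random index by a fixed coin, which is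
  -- known at time zero.
  have h : {ω | rootTime S b ξ ω ≤ (t : WithTop ℕ)}
      = ⋃ s : ℕ, ⋃ _ : s ≤ t, ⋃ y : ℤ, ⋃ _ : b y ≤ s, S s ⁻¹' {y} ∩ ξ s y ⁻¹' {0} := by
    ext ω
    have := (coe_succ_le_iff (t := t) (a := rootTime S b ξ ω)).symm.trans coe_le_rootTime_iff
    rw [Set.mem_ofPred_eq, ← not_lt, this]
    simp only [Set.mem_iUnion, Set.mem_inter_iff, Set.mem_preimage, Set.mem_singleton_iff,
      exists_prop, Nat.lt_succ_iff]
    push Not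
    constructor
    · rintro ⟨s, hs, h1, h2⟩
      exact ⟨s, hs, _, h1, rfl, h2⟩
    · rintro ⟨s, hs, y, h1, rfl, h2⟩
      exact ⟨s, hs, h1, h2⟩
  change MeasurableSet[F t] {ω | rootTime S b ξ ω ≤ (t : WithTop ℕ)}
  rw [h]
  refine MeasurableSet.iUnion fun s => MeasurableSet.iUnion fun hs => MeasurableSet.iUnion fun y =>
    MeasurableSet.iUnion fun _ => MeasurableSet.inter ?_ ?_
  · exact F.mono hs _ (hS.adapted s (measurableSet_singleton y))
  · exact F.mono (Nat.zero_le t) _ (hc.measurable s y (measurableSet_singleton 0))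

end RootTime

/-! ### Independence of a coin from the past and the walk -/

section Independence

/-- If `X` and `Y` are independent and jointly independent of `Z`, then `X` is independent of the
pair of `Y` and `Z`. -/
theorem indepFun_prodMk_of_indepFun [IsProbabilityMeasure P] {α β γ : Type*} [MeasurableSpace α]
    [MeasurableSpace β] [MeasurableSpace γ] {X : Ω → α} {Y : Ω → β} {Z : Ω → γ}
    (hX : Measurable X) (hY : Measurable Y) (hZ : Measurable Z) (hXY : IndepFun X Y P)
    (hXYZ : IndepFun (fun ω => (X ω, Y ω)) Z P) : IndepFun X (fun ω => (Y ω, Z ω)) P := by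
  have := Measure.isProbabilityMeasure_map (μ := P) hX.aemeasurable
  have := Measure.isProbabilityMeasure_map (μ := P) hY.aemeasurable
  have := Measure.isProbabilityMeasure_map (μ := P) hZ.aemeasurable
  have hYZ : IndepFun Y Z P := hXYZ.comp measurable_snd measurable_id
  rw [indepFun_iff_map_prod_eq_prod_map_map (by fun_prop) (by fun_prop)] at hXY hXYZ hYZ ⊢
  rw [hYZ, ← Measure.prodAssoc_prod, ← hXY, ← hXYZ, Measure.map_map (by fun_prop) (by fun_prop)]
  rfl

theorem IsCoinFamily.measurable' (hc : IsCoinFamily F P S b r ξ) (t : ℕ) (x : ℤ) :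
    Measurable (ξ t x) := (hc.measurable t x).mono (F.le 0) le_rfl

/-- A coin is independent of the coins of earlier times together with the walk. -/
theorem IsCoinFamily.indepFun_past [IsProbabilityMeasure P] (hS : IsSSRW F P S)
    (hc : IsCoinFamily F P S b r ξ) (t : ℕ) (x : ℤ) :
    IndepFun (ξ t x) (fun ω => ((fun p : {p : ℕ × ℤ // p.1 < t} => ξ p.1.1 p.1.2 ω),
      fun s : ℕ => S s ω)) P := by
  refine indepFun_prodMk_of_indepFun (hc.measurable' t x)
    (measurable_pi_lambda _ fun p => hc.measurable' _ _)
    (measurable_pi_lambda _ fun s => hS.measurable s) ?_ ?_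
  -- Mutual independence is grouped over two disjoint index sets: the node `(t, x)` and all nodes of
  -- earlier times.
  · have h := indep_iSup_of_disjoint (fun p : ℕ × ℤ => (hc.measurable' p.1 p.2).comap_le)
      hc.iIndep (S := {(t, x)}) (T := {p | p.1 < t})
      (Set.disjoint_left.2 fun p h1 h2 => by
        rw [Set.mem_singleton_iff] at h1
        subst h1
        exact lt_irrefl t h2)
    refine indep_of_indep_of_le_left (indep_of_indep_of_le_right h ?_) ?_
    · rw [MeasurableSpace.pi, MeasurableSpace.comap_iSup]
      refine iSup_le fun p => ?_
      rw [MeasurableSpace.comap_comp]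
      exact le_iSup₂_of_le p.1 p.2 le_rfl
    · exact le_iSup₂_of_le (t, x) rfl le_rfl
  · exact hc.indep_walk.comp
      (φ := fun w : ℕ × ℤ → Fin 2 => (w (t, x), fun p : {p : ℕ × ℤ // p.1 < t} => w p.1))
      (by fun_prop) measurable_id

/-- Surviving a node means arriving there and not being stopped by its coin. -/
theorem IsCoinFamily.alive_eq [IsProbabilityMeasure P] (hS : IsSSRW F P S)
    (hr : ∀ x, r x ∈ Set.Icc (0 : ℝ) 1) (hc : IsCoinFamily F P S b r ξ) (t : ℕ) (x : ℤ) :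
    alive P S (rootTime S b ξ) t x
      = arrive P S (rootTime S b ξ) t x * (1 - stopProb b r t x) := by
  by_cases hlt : (t : ℤ) < b x
  · rw [stopProb, if_pos hlt, sub_zero, mul_one, alive, arrive]
    congr 1
    ext ω
    simp only [Set.mem_ofPred_eq, coe_lt_rootTime_iff]
    constructor
    · exact fun h => ⟨h.1, h.2.1⟩
    · rintro ⟨rfl, h2⟩
      exact ⟨rfl, h2, fun h => absurd h.1 (not_le.2 hlt)⟩
  let A := {ω | S t ω = x ∧ (t : WithTop ℕ) ≤ rootTime S b ξ ω}
  -- Arrival at `(t, x)` depends only on the walk and the coins of times before `t`. `B` is this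
  -- event in path space, which makes `A` independent of `ξ t x`.
  let B : Set (({p : ℕ × ℤ // p.1 < t} → Fin 2) × (ℕ → ℤ)) :=
    {w | w.2 t = x} ∩ ⋂ (s : ℕ) (hs : s < t) (y : ℤ) (_ : b y ≤ s),
      ({w | w.2 s = y} ∩ {w | w.1 ⟨(s, y), hs⟩ = 0})ᶜ
  have hB : MeasurableSet B := by
    refine MeasurableSet.inter ?_ (MeasurableSet.iInter fun s => MeasurableSet.iInter fun hs =>
      MeasurableSet.iInter fun y => MeasurableSet.iInter fun _ =>
        (MeasurableSet.inter ?_ ?_).compl)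
    · exact measurableSet_eq_fun (by fun_prop) measurable_const
    · exact measurableSet_eq_fun (by fun_prop) measurable_const
    · exact measurableSet_eq_fun (by fun_prop) measurable_const
  have hAB : A = (fun ω => ((fun p : {p : ℕ × ℤ // p.1 < t} => ξ p.1.1 p.1.2 ω),
      fun s : ℕ => S s ω)) ⁻¹' B := by
    ext ω
    simp only [A, B, Set.mem_ofPred_eq, coe_le_rootTime_iff, Set.mem_preimage, Set.mem_inter_iff,
      Set.mem_iInter, Set.mem_compl_iff]
    refine and_congr_right fun _ => ⟨?_, ?_⟩
    · rintro h s hs _ hb ⟨rfl, h0⟩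
      exact h s hs ⟨hb, h0⟩
    · rintro h s hs ⟨hb, h0⟩
      exact h s hs _ hb ⟨rfl, h0⟩
  have hind := (hc.indepFun_past hS t x).measure_inter_preimage_eq_mul _ _
    (measurableSet_singleton 0) hB
  rw [← hAB] at hind
  have hlaw : P.real (ξ t x ⁻¹' {0}) = stopProb b r t x :=
    (congrArg ENNReal.toReal (hc.law t x)).trans (ENNReal.toReal_ofReal (stopProb_mem hr t x).1)
  have hind' : P.real (ξ t x ⁻¹' {0} ∩ A) = stopProb b r t x * P.real A := by
    rw [← hlaw, measureReal_def, hind, ENNReal.toReal_mul]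
    rfl
  have hset : {ω | S t ω = x ∧ (t : WithTop ℕ) < rootTime S b ξ ω} = A \ (ξ t x ⁻¹' {0}) := by
    ext ω
    simp only [A, Set.mem_ofPred_eq, coe_lt_rootTime_iff, Set.mem_sdiff, Set.mem_preimage,
      Set.mem_singleton_iff, and_assoc]
    refine and_congr_right ?_
    rintro rfl
    refine and_congr_right fun _ => not_congr ⟨fun h => h.2, fun h => ⟨not_lt.1 hlt, h⟩⟩
  have hsum := measureReal_sdiff_add_inter (μ := P) (s := A)
    (hc.measurable' t x (measurableSet_singleton 0))
  rw [Set.inter_comm, hind'] at hsum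
  rw [alive, hset, show arrive P S (rootTime S b ξ) t x = P.real A from rfl]
  linarith

end Independence

/-! ### Construction of coins from a uniform variable -/

section Existence

/-- The law on `Fin 2` giving mass `s` to `0` and mass `1 - s` to `1`. -/
noncomputable def coinLaw (s : ℝ) : Measure (Fin 2) :=
  ENNReal.ofReal s • Measure.dirac 0 + ENNReal.ofReal (1 - s) • Measure.dirac 1

theorem isProbabilityMeasure_coinLaw {s : ℝ} (hs : s ∈ Set.Icc (0 : ℝ) 1) :
    IsProbabilityMeasure (coinLaw s) := by
  constructor
  simp only [coinLaw, Measure.add_apply, Measure.smul_apply, measure_univ, smul_eq_mul, mul_one]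
  rw [← ENNReal.ofReal_add hs.1 (sub_nonneg.2 hs.2)]
  simp

theorem coinLaw_zero (s : ℝ) : coinLaw s {0} = ENNReal.ofReal s := by
  simp [coinLaw]

/-- A uniform variable, projected to the unit interval, has the Lebesgue measure as its law. -/
theorem map_projIcc_eq_volume {ζ : Ω → ℝ} (hζ : Measurable ζ)
    (hlaw : P.map ζ = volume.restrict (Set.Icc (0 : ℝ) 1)) :
    P.map (fun ω => Set.projIcc (0 : ℝ) 1 zero_le_one (ζ ω)) = volume := by
  have hproj : Measurable (Set.projIcc (0 : ℝ) 1 zero_le_one) := continuous_projIcc.measurable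
  have h := unitInterval.measurePreserving_coe.map_eq
  change P.map (Set.projIcc (0 : ℝ) 1 zero_le_one ∘ ζ) = volume
  rw [← Measure.map_map hproj hζ, hlaw]
  change (volume.restrict unitInterval).map _ = _
  rw [← h, Measure.map_map hproj measurable_subtype_coe]
  convert! Measure.map_id
  ext x
  simp

/-- A uniform variable known at time zero and independent of the walk yields families of coins. -/
theorem exists_isCoinFamily [IsProbabilityMeasure P] (hr : ∀ x, r x ∈ Set.Icc (0 : ℝ) 1)
    {ζ : Ω → ℝ} (hζ : Measurable[F 0] ζ) (hlaw : P.map ζ = volume.restrict (Set.Icc (0 : ℝ) 1))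
    (hind : IndepFun ζ (fun ω (t : ℕ) => S t ω) P) :
    ∃ ξ : ℕ → ℤ → Ω → Fin 2, IsCoinFamily F P S b r ξ := by
  let ν : ℕ × ℤ → Measure (Fin 2) := fun p => coinLaw (stopProb b r p.1 p.2)
  have (p : ℕ × ℤ) : IsProbabilityMeasure (ν p) :=
    isProbabilityMeasure_coinLaw (stopProb_mem hr p.1 p.2)
  -- The product law of all coins is the image of Lebesgue measure on the unit interval under one
  -- measurable map, so a single uniform variable yields all coins.
  obtain ⟨f, hf, hfν⟩ := (Measure.infinitePi ν).exists_measurable_map_eq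
  let φ : ℝ → ℕ × ℤ → Fin 2 := fun z => f (Set.projIcc (0 : ℝ) 1 zero_le_one z)
  have hφ : Measurable φ := hf.comp continuous_projIcc.measurable
  have hζ' : Measurable ζ := hζ.mono (F.le 0) le_rfl
  have hφζ : Measurable fun ω => φ (ζ ω) := hφ.comp hζ'
  have hjoint : P.map (fun ω => φ (ζ ω)) = Measure.infinitePi ν := by
    have hproj : Measurable fun ω => Set.projIcc (0 : ℝ) 1 zero_le_one (ζ ω) :=
      continuous_projIcc.measurable.comp hζ'
    rw [← hfν, ← map_projIcc_eq_volume hζ' hlaw, Measure.map_map hf hproj]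
    rfl
  have heval (p : ℕ × ℤ) : P.map (fun ω => φ (ζ ω) p) = ν p := by
    rw [← Measure.infinitePi_map_eval ν p, ← hjoint,
      Measure.map_map (measurable_pi_apply p) hφζ]
    rfl
  refine ⟨fun t x ω => φ (ζ ω) (t, x), fun t x => ?_, fun t x => ?_, ?_, ?_⟩
  · exact ((measurable_pi_apply _).comp hφ).comp hζ
  · rw [← coinLaw_zero, ← show _ = coinLaw (stopProb b r t x) from heval (t, x),
      Measure.map_apply (by fun_prop) (measurableSet_singleton 0)]
    rfl
  · refine (iIndepFun_iff_map_fun_eq_infinitePi_map₀ hφζ.aemeasurable).2 ?_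
    exact hjoint.trans (congrArg Measure.infinitePi (funext heval)).symm
  · exact hind.comp hφ measurable_id

end Existence

end RootEmbedding

/-! ### The main theorem -/

theorem theorem1 {Ω : Type*} {m : MeasurableSpace Ω} (P : Measure Ω)
    [IsProbabilityMeasure P] (F : Filtration ℕ m)
    (S : ℕ → Ω → ℤ) (hS : IsSSRW F P S)
    (hrich : ∃ ζ : Ω → ℝ, Measurable[F 0] ζ ∧
      P.map ζ = volume.restrict (Set.Icc (0 : ℝ) 1) ∧
      IndepFun ζ (fun ω (t : ℕ) => S t ω) P)
    (T : ℕ) (hT : 1 ≤ T) (μ : Measure ℤ) (hμ : IsCentered μ)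
    (hsupp : μ (Set.Icc (-(T : ℤ)) (T : ℤ)) = 1) :
    ((∃ τ : Ω → WithTop ℕ, Admissible F P T τ ∧ Embeds P S τ μ) ↔
      ∀ x : ℤ, -((T : ℤ) - 2) ≤ x → x ≤ (T : ℤ) - 2 → Even (x - (T : ℤ)) →
        potential μ x ≤
          (evol μ (T - 1) (x + 1) + evol μ (T - 1) (x - 1)) / 2) ∧
    ((∀ x : ℤ, -((T : ℤ) - 2) ≤ x → x ≤ (T : ℤ) - 2 → Even (x - (T : ℤ)) →
        potential μ x ≤
          (evol μ (T - 1) (x + 1) + evol μ (T - 1) (x - 1)) / 2) →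
      ∃ (b : ℤ → ℤ) (r : ℤ → ℝ), IsBarrier b ∧ (∀ x, r x ∈ Set.Icc (0 : ℝ) 1) ∧
        (∃ ξ : ℕ → ℤ → Ω → Fin 2, IsCoinFamily F P S b r ξ) ∧
        ∀ ξ : ℕ → ℤ → Ω → Fin 2, IsCoinFamily F P S b r ξ →
          Admissible F P T (rootTime S b ξ) ∧
          Embeds P S (rootTime S b ξ) μ) := by
  have root : Criterion μ T →
      ∃ (b : ℤ → ℤ) (r : ℤ → ℝ), IsBarrier b ∧ (∀ x, r x ∈ Set.Icc (0 : ℝ) 1) ∧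
        (∃ ξ : ℕ → ℤ → Ω → Fin 2, IsCoinFamily F P S b r ξ) ∧
        ∀ ξ : ℕ → ℤ → Ω → Fin 2, IsCoinFamily F P S b r ξ →
          Admissible F P T (rootTime S b ξ) ∧ Embeds P S (rootTime S b ξ) μ := by
    intro h
    obtain ⟨b, hb⟩ := h.exists_isRootBarrier hT hμ hsupp
    obtain ⟨ζ, hζ, hlaw, hind⟩ := hrich
    have hr := hb.barrierProb_mem hμ
    refine ⟨fun x => b x, barrierProb μ b, hb.isBarrier, hr,
      exists_isCoinFamily hr hζ hlaw hind, fun ξ hξ => ?_⟩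
    have hτ := hξ.isStoppingTime hS
    exact hS.embeds_of_alive hμ hτ
      (hb.alive_eq hμ hS.arrive_zero (hS.arrive_succ hτ) (hξ.alive_eq hS hr))
      (h.evol_eq hT hμ hsupp)
  refine ⟨⟨fun ⟨τ, hτ, he⟩ => hS.criterion_of_embeds hT hμ hsupp hτ he, fun h => ?_⟩, root⟩
  -- The Root time of any one coin family witnesses the converse implication.
  obtain ⟨b, r, -, -, ⟨ξ, hξ⟩, hroot⟩ := root h
  exact ⟨rootTime S b ξ, hroot ξ hξ⟩
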